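/- Let $S$ be a commutative Noetherian ring and let $\Gamma$ be a (not necessarily commutative) $S$-algebra which is finitely generated as an $S$-module. Modules are left modules (the version for right modules is obtained by replacing $\Gamma$ by $\Gamma^{\mathrm{op}}$). For a ring $A$, a one-sided tilting complex for $A$ is a bounded complex $T$ of finitely generated projective $A$-modules such that (i) $\operatorname{Hom}_{\mathrm D(\operatorname{Mod} A)}(T,T[t])=0$ for all integers $t\neq 0$; and (ii) if $X\in \mathrm D(\operatorname{Mod} A)$ (the unbounded derived category) satisfies $\mathbf{R}\mathrm{Hom}_A(T,X)=0$, i.e. $\operatorname{Hom}_{\mathrm D(\operatorname{Mod} A)}(T,X[n])=0$ for all $n\in\mathbb Z$, then $X\cong 0$. For a prime $\mathfrak p\in\operatorname{Spec} S$ let $\hat S_{\mathfrak p}$ be the completion of the local ring $S_{\mathfrak p}$ at its maximal ideal, and put $\Gamma_{\mathfrak p}=S_{\mathfrak p}\otimes_S\Gamma$ and $\hat\Gamma_{\mathfrak p}=\hat S_{\mathfrak p}\otimes_{S_{\mathfrak p}}\Gamma_{\mathfrak p}$. Let $T$ be a bounded complex of finitely generated projective $\Gamma$-modules. Then the following are equivalent: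 (1) $T$ is a one-sided tilting complex for $\Gamma$; (2) for every $\mathfrak p\in\operatorname{Spec} S$, the complex $T_{\mathfrak p}=S_{\mathfrak p}\otimes_S T$ is a one-sided tilting complex for $\Gamma_{\mathfrak p}$; (3) for every $\mathfrak p\in\operatorname{Spec} S$, the complex $\hat S_{\mathfrak p}\otimes_{S_{\mathfrak p}}T_{\mathfrak p}$ is a one-sided tilting complex for $\hat\Gamma_{\mathfrak p}$. -/

import Mathlib

open CategoryTheory TensorProduct

universe u

namespace OneSidedTilting

noncomputable section

/-- A choice of the derived category `D(Mod Γ)`: the category of all (unbounded) cochain complexes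
of `Γ`-modules, localised at the quasi-isomorphisms. -/
instance hasDerivedCategoryModuleCat (Γ : Type u) [Ring Γ] :
    HasDerivedCategory.{u + 1} (ModuleCat.{u} Γ) :=
  HasDerivedCategory.standard _

section Tilting

variable {Γ : Type u} [Ring Γ]

/-- `T` is an object of `K^b(proj Γ)`: a bounded complex of finitely generated projective
`Γ`-modules. -/
structure IsBoundedProj (T : CochainComplex (ModuleCat.{u} Γ) ℤ) : Prop where
  projective : ∀ i : ℤ, Module.Projective Γ (T.X i)
  finite : ∀ i : ℤ, Module.Finite Γ (T.X i)
  bounded : ∃ a b : ℤ, ∀ i : ℤ, i < a ∨ b < i → Limits.IsZero (T.X i)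

/-- `RHom_Γ(T, X) = 0` in the derived category of abelian groups, i.e. all its cohomology groups
`Hⁿ(RHom_Γ(T, X)) = Hom_{D(Γ)}(T, X[n])` vanish. -/
def RHomVanishes (T : CochainComplex (ModuleCat.{u} Γ) ℤ)
    (X : DerivedCategory (ModuleCat.{u} Γ)) : Prop :=
  ∀ n : ℤ, ∀ f : DerivedCategory.Q.obj T ⟶ X⟦n⟧, f = 0

/-- `T` is a one-sided tilting complex for `Γ`. -/
structure IsOneSidedTilting (T : CochainComplex (ModuleCat.{u} Γ) ℤ) : Prop where
  isBoundedProj : IsBoundedProj T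
  hom_shift_eq_zero : ∀ t : ℤ, t ≠ 0 →
    ∀ f : DerivedCategory.Q.obj T ⟶ (DerivedCategory.Q.obj T)⟦t⟧, f = 0
  isZero_of_rHomVanishes : ∀ X : DerivedCategory (ModuleCat.{u} Γ),
    RHomVanishes T X → Limits.IsZero X

end Tilting

section BaseChange

variable {S : Type u} [CommRing S] (A : Type u) [CommRing A] [Algebra S A]
  {Γ : Type u} [Ring Γ] [Algebra S Γ]

/-- A module over the `S`-algebra `Γ`, regarded as an `S`-module. -/
abbrev moduleOfAlgebra (M : ModuleCat.{u} Γ) : Module S M :=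
  Module.restrictScalars S Γ M

attribute [local instance] moduleOfAlgebra

theorem isScalarTower_moduleOfAlgebra (M : ModuleCat.{u} Γ) : IsScalarTower S Γ M :=
  IsScalarTower.restrictScalars S Γ M

attribute [local instance] isScalarTower_moduleOfAlgebra

/-- The action of `A ⊗[S] Γ` on `A ⊗[S] M`, by `(a ⊗ γ) • (b ⊗ m) = (a * b) ⊗ (γ • m)`. -/
def baseChangeAction (M : ModuleCat.{u} Γ) :
    A ⊗[S] Γ →ₐ[S] Module.End S (A ⊗[S] M) :=
  (Module.endTensorEndAlgHom (R := S) (S := S) (A := S) (M := A) (N := M)).comp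
    (Algebra.TensorProduct.map (Algebra.lmul S A) (Algebra.lsmul S S M))

theorem baseChangeAction_tmul_tmul (M : ModuleCat.{u} Γ) (a b : A) (g : Γ) (m : M) :
    baseChangeAction (S := S) A M (a ⊗ₜ[S] g) (b ⊗ₜ[S] m) = (a * b) ⊗ₜ[S] (g • m) := rfl

/-- The `A ⊗[S] Γ`-module `A ⊗[S] M`. -/
def baseChangeObj (M : ModuleCat.{u} Γ) : ModuleCat.{u} (A ⊗[S] Γ) :=
  @ModuleCat.of (A ⊗[S] Γ) _ (A ⊗[S] M) _
    (Module.compHom (A ⊗[S] M) (baseChangeAction (S := S) A M).toRingHom)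

/-- The base change `id ⊗ f` of a `Γ`-linear map `f`. -/
def baseChangeMap {M N : ModuleCat.{u} Γ} (f : M ⟶ N) :
    baseChangeObj (S := S) A M ⟶ baseChangeObj (S := S) A N :=
  letI := Module.compHom (A ⊗[S] M) (baseChangeAction (S := S) A M).toRingHom
  letI := Module.compHom (A ⊗[S] N) (baseChangeAction (S := S) A N).toRingHom
  ModuleCat.ofHom (X := A ⊗[S] M) (Y := A ⊗[S] N)
    { toFun := TensorProduct.map (LinearMap.id : A →ₗ[S] A) (f.hom.restrictScalars S)
      map_add' := map_add _
      map_smul' := by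
        intro r x
        change TensorProduct.map _ _ (baseChangeAction A M r x) =
          baseChangeAction A N r (TensorProduct.map _ _ x)
        induction r using TensorProduct.induction_on with
        | zero => simp
        | add r₁ r₂ h₁ h₂ => simp only [map_add, LinearMap.add_apply, h₁, h₂]
        | tmul a g =>
          induction x using TensorProduct.induction_on with
          | zero => simp
          | add x₁ x₂ h₁ h₂ => simp only [map_add, h₁, h₂]
          | tmul b m =>
            simp [baseChangeAction_tmul_tmul] }

theorem baseChangeMap_apply {M N : ModuleCat.{u} Γ} (f : M ⟶ N) (x : A ⊗[S] M) :
    (baseChangeMap (S := S) A f).hom x =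
      (TensorProduct.map (LinearMap.id : A →ₗ[S] A) (f.hom.restrictScalars S) x : A ⊗[S] N) :=
  rfl

theorem baseChangeMap_id (M : ModuleCat.{u} Γ) :
    baseChangeMap (S := S) A (𝟙 M) = 𝟙 _ := by
  refine ModuleCat.hom_ext (LinearMap.ext fun x => ?_)
  exact LinearMap.congr_fun (TensorProduct.map_id (R := S) (M := A) (N := M)) x

theorem baseChangeMap_comp {M N P : ModuleCat.{u} Γ} (f : M ⟶ N) (g : N ⟶ P) :
    baseChangeMap (S := S) A (f ≫ g) = baseChangeMap A f ≫ baseChangeMap A g := by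
  refine ModuleCat.hom_ext (LinearMap.ext fun x => ?_)
  exact LinearMap.congr_fun (TensorProduct.map_comp (LinearMap.id : A →ₗ[S] A)
    (g.hom.restrictScalars S) (LinearMap.id : A →ₗ[S] A) (f.hom.restrictScalars S)) x

theorem baseChangeMap_add {M N : ModuleCat.{u} Γ} (f g : M ⟶ N) :
    baseChangeMap (S := S) A (f + g) = baseChangeMap A f + baseChangeMap A g := by
  refine ModuleCat.hom_ext (LinearMap.ext fun x => ?_)
  exact LinearMap.congr_fun (TensorProduct.map_add_right (LinearMap.id : A →ₗ[S] A)
    (f.hom.restrictScalars S) (g.hom.restrictScalars S)) x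

variable (S Γ) in
/-- The functor `A ⊗[S] - : Mod Γ ⥤ Mod (A ⊗[S] Γ)`. -/
def baseChange : ModuleCat.{u} Γ ⥤ ModuleCat.{u} (A ⊗[S] Γ) where
  obj M := baseChangeObj A M
  map f := baseChangeMap A f
  map_id M := baseChangeMap_id A M
  map_comp f g := baseChangeMap_comp A f g

instance baseChange_additive : (baseChange S A Γ).Additive where
  map_add {_ _} f g := baseChangeMap_add A f g

variable (S) in
/-- The complex `A ⊗[S] T` of `A ⊗[S] Γ`-modules, for a complex `T` of `Γ`-modules. -/
def baseChangeComplex (T : CochainComplex (ModuleCat.{u} Γ) ℤ) :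
    CochainComplex (ModuleCat.{u} (A ⊗[S] Γ)) ℤ :=
  ((baseChange S A Γ).mapHomologicalComplex (ComplexShape.up ℤ)).obj T

end BaseChange

section Localization

variable {S : Type u} [CommRing S] (p : PrimeSpectrum S)

/-- The localisation `S_p`. -/
abbrev LocRing : Type u := Localization.AtPrime p.asIdeal

/-- The completion of the local ring `S_p` at its maximal ideal. -/
abbrev ComplRing : Type u := AdicCompletion (IsLocalRing.maximalIdeal (LocRing p)) (LocRing p)

variable {Γ : Type u} [Ring Γ] [Algebra S Γ] (T : CochainComplex (ModuleCat.{u} Γ) ℤ)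

/-- `T_p = S_p ⊗[S] T`, a complex of modules over `Γ_p = S_p ⊗[S] Γ`. -/
abbrev localizedComplex : CochainComplex (ModuleCat.{u} (LocRing p ⊗[S] Γ)) ℤ :=
  baseChangeComplex S (LocRing p) T

/-- `Ŝ_p ⊗[S_p] T_p`, a complex of modules over `Ŝ_p ⊗[S_p] Γ_p`, the completion of `Γ_p`. -/
abbrev completedComplex :
    CochainComplex (ModuleCat.{u} (ComplRing p ⊗[LocRing p] (LocRing p ⊗[S] Γ))) ℤ :=
  baseChangeComplex (LocRing p) (ComplRing p) (localizedComplex p T)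

end Localization

end

end OneSidedTilting

/-!
Both equivalences are instances of one statement, `JointlyFaithful.isOneSidedTilting_iff`: if
`(A j)` is a family of flat `S`-algebras such that an `S`-module `M` is zero as soon as all
`A j ⊗[S] M` are, then a bounded complex `T` of finitely generated projective `Γ`-modules is a
one-sided tilting complex if and only if all the complexes `A j ⊗[S] T` are. It is applied to the
family of all localisations `S_p` over `S`, and to the faithfully flat algebra `Ŝ_p` over `S_p`.

As `T` is bounded with projective terms it is K-projective, so `Hom(T, K[n])` in the derived
category is the `n`-th cohomology of the Hom complex (`hom_Q_obj_eq_zero_iff`). The general statement then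
rests on three facts.

* For `A` an arbitrary commutative `S`-algebra, `A ⊗[S] Hom(T, K) → Hom(A ⊗[S] T, A ⊗[S] K)` is an
  isomorphism of complexes (`δ_comparison`, `comparison_bijective`); in terms of dual bases of the
  terms of `T` the inverse is explicit. With flatness, the vanishing of `Hom(T, K[n])` implies that
  of `Hom(A ⊗[S] T, A ⊗[S] K[n])` (`HomExactAt.baseChange`). For a jointly faithful family, the
  converse holds too (`JointlyFaithful.homExactAt`). Taking `K = T` settles the condition on
  self-extensions in both directions.
* If `Hom(A ⊗[S] T, X[n]) = 0` for all `n`, then, by the adjunction between extension and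
  restriction of scalars, `Hom(T, X[n]) = 0` for all `n` over `Γ` (`HomExactAt.restrictScalars`).
  Hence `X` is zero if `T` generates, because restriction of scalars detects acyclicity.
* If `Hom(T, K[n]) = 0` for all `n`, then `Hom(A j ⊗[S] T, A j ⊗[S] K[n]) = 0` by the first fact, so
  `A j ⊗[S] K` is acyclic for all `j` if all the `A j ⊗[S] T` generate, and then `K` is acyclic
  (`JointlyFaithful.acyclic`).
-/

namespace OneSidedTilting

open CategoryTheory TensorProduct CochainComplex HomComplex

/-! ### Morphisms from K-projective complexes in the derived category -/

section Derived

universe w' v' u'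

variable {C : Type u'} [Category.{v'} C]

/-- The Hom complex `Hom(K, L)` has no cohomology in degree `n`: every cocycle is a coboundary. -/
def HomExactAt [Preadditive C] (K L : CochainComplex C ℤ) (n : ℤ) : Prop :=
  ∀ z : Cochain K L n, δ n (n + 1) z = 0 → ∃ y : Cochain K L (n - 1), δ (n - 1) n y = z

theorem subsingleton_cohomologyClass_iff [Preadditive C] (K L : CochainComplex C ℤ) (n : ℤ) :
    Subsingleton (CohomologyClass K L n) ↔ HomExactAt K L n := by
  constructor
  · intro h z hz
    have := (CohomologyClass.mk_eq_zero_iff (Cocycle.mk z (n + 1) rfl hz)).1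
      (Subsingleton.elim _ _)
    exact (mem_coboundaries_iff _ (n - 1) (by lia)).1 this
  · intro h
    refine subsingleton_of_forall_eq 0 fun x => ?_
    obtain ⟨x, rfl⟩ := x.mk_surjective
    rw [CohomologyClass.mk_eq_zero_iff, mem_coboundaries_iff _ (n - 1) (by lia)]
    exact h x (x.δ_eq_zero _)

variable [Abelian C] [HasDerivedCategory.{w'} C]

/-- Morphisms in the derived category from a K-projective complex are homotopy classes of morphisms
of complexes. -/
theorem hom_Q_obj_eq_zero_iff (K L : CochainComplex C ℤ) [K.IsKProjective] (n : ℤ) :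
    (∀ f : DerivedCategory.Q.obj K ⟶ (DerivedCategory.Q.obj L)⟦n⟧, f = 0) ↔
      HomExactAt K L n := by
  rw [← subsingleton_cohomologyClass_iff]
  let e : CohomologyClass K L n ≃ (DerivedCategory.Q.obj K ⟶ (DerivedCategory.Q.obj L)⟦n⟧) :=
    (Equiv.ofBijective _ (CohomologyClass.toHom_bijective K L n)).trans <|
      (Equiv.ofBijective _ (IsKProjective.Qh_map_bijective K _)).trans <|
        Iso.homCongr ((DerivedCategory.quotientCompQhIso C).app K)
          ((DerivedCategory.quotientCompQhIso C).app (L⟦n⟧) ≪≫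
            (DerivedCategory.Q.commShiftIso n).app L)
  rw [e.subsingleton_congr]
  exact ⟨fun h => subsingleton_of_forall_eq 0 h, fun h f => Subsingleton.elim _ _⟩

theorem isZero_Q_obj_iff (K : CochainComplex C ℤ) :
    Limits.IsZero (DerivedCategory.Q.obj K) ↔ K.Acyclic := by
  constructor
  · intro h i
    rw [HomologicalComplex.exactAt_iff_isZero_homology]
    exact ((DerivedCategory.homologyFunctor C i).map_isZero h).of_iso
      ((DerivedCategory.homologyFunctorFactors C i).symm.app K)
  · intro h
    -- The zero endomorphism of an acyclic complex is a quasi-isomorphism.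
    have : QuasiIso (0 : K ⟶ K) :=
      ⟨fun i => (quasiIsoAt_iff_exactAt _ i (h i)).2 (h i)⟩
    have : IsIso (0 : DerivedCategory.Q.obj K ⟶ DerivedCategory.Q.obj K) := by
      rw [← DerivedCategory.Q.map_zero]
      infer_instance
    exact Limits.IsZero.of_mono_zero _ (DerivedCategory.Q.obj K)

end Derived

section ModuleComplex

variable {Γ : Type u} [Ring Γ]

theorem acyclic_iff_of_moduleCat (K : CochainComplex (ModuleCat.{u} Γ) ℤ) :
    K.Acyclic ↔ ∀ i : ℤ, ∀ x : K.X i, (K.d i (i + 1)).hom x = 0 →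
      ∃ y : K.X (i - 1), (K.d (i - 1) i).hom y = x := by
  refine forall_congr' fun i => ?_
  rw [HomologicalComplex.exactAt_iff' K (i - 1) i (i + 1) (by simp) (by simp),
    ShortComplex.moduleCat_exact_iff]
  rfl

theorem IsBoundedProj.isKProjective {T : CochainComplex (ModuleCat.{u} Γ) ℤ}
    (hT : IsBoundedProj T) : T.IsKProjective := by
  obtain ⟨a, b, hab⟩ := hT.bounded
  have : T.IsStrictlyLE b := by
    rw [CochainComplex.isStrictlyLE_iff]
    exact fun i hi => hab i (Or.inr hi)
  have (i : ℤ) : Projective (T.X i) := by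
    rw [← IsProjective.iff_projective]
    exact hT.projective i
  exact CochainComplex.isKProjective_of_projective T b

/-- The tilting conditions in terms of cochains, without reference to the derived category. -/
theorem isOneSidedTilting_iff {T : CochainComplex (ModuleCat.{u} Γ) ℤ} (hT : IsBoundedProj T) :
    IsOneSidedTilting T ↔ (∀ t : ℤ, t ≠ 0 → HomExactAt T T t) ∧
      ∀ K : CochainComplex (ModuleCat.{u} Γ) ℤ, (∀ n, HomExactAt T K n) → K.Acyclic := by
  have := hT.isKProjective
  have key : (∀ X : DerivedCategory (ModuleCat.{u} Γ), RHomVanishes T X → Limits.IsZero X) ↔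
      ∀ K : CochainComplex (ModuleCat.{u} Γ) ℤ, (∀ n, HomExactAt T K n) → K.Acyclic := by
    simp only [← isZero_Q_obj_iff, ← hom_Q_obj_eq_zero_iff]
    refine ⟨fun h K hK => h _ hK, fun h X hX => ?_⟩
    let e := DerivedCategory.Q.objObjPreimageIso X
    refine (h _ fun n f => ?_).of_iso e.symm
    rw [← cancel_mono ((CategoryTheory.shiftFunctor _ n).map e.hom), hX n (f ≫ _), Limits.zero_comp]
  rw [← key]
  simp only [← hom_Q_obj_eq_zero_iff]
  exact ⟨fun h => ⟨h.2, h.3⟩, fun h => ⟨hT, h.1, h.2⟩⟩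

end ModuleComplex

/-! ### Base change of modules and finitely generated projectives -/

section DualBasis

variable {Γ : Type*} [Ring Γ] {P : Type*} [AddCommGroup P] [Module Γ P]

/-- The dual basis lemma for finitely generated projective modules. -/
theorem exists_dualBasis (Γ P : Type*) [Ring Γ] [AddCommGroup P] [Module Γ P]
    [Module.Finite Γ P] [Module.Projective Γ P] :
    ∃ (k : ℕ) (e : Fin k → P) (f : Fin k → P →ₗ[Γ] Γ), ∀ x, ∑ j, f j x • e j = x := by
  obtain ⟨k, s, i, -, -, h⟩ := Module.Finite.exists_comp_eq_id_of_projective Γ P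
  refine ⟨k, fun j => s (Pi.single j 1), fun j => LinearMap.proj j ∘ₗ i, fun x => ?_⟩
  conv_rhs => rw [← LinearMap.id_apply (R := Γ) x, ← h, LinearMap.comp_apply,
    LinearMap.pi_apply_eq_sum_univ s (i x)]
  exact Finset.sum_congr rfl fun j _ => by
    refine congrArg _ (congrArg s ?_)
    funext l
    simp [Pi.single_apply, eq_comm]

theorem finite_and_projective_of_dualBasis {k : ℕ} (e : Fin k → P) (f : Fin k → P →ₗ[Γ] Γ)
    (h : ∀ x, ∑ j, f j x • e j = x) : Module.Finite Γ P ∧ Module.Projective Γ P := by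
  have hc : Fintype.linearCombination Γ e ∘ₗ LinearMap.pi f = LinearMap.id :=
    LinearMap.ext fun x => by simpa [Fintype.linearCombination_apply] using h x
  exact ⟨.of_surjective (Fintype.linearCombination Γ e) fun x => ⟨_, LinearMap.congr_fun hc x⟩,
    .of_split _ _ hc⟩

end DualBasis

attribute [local instance] moduleOfAlgebra isScalarTower_moduleOfAlgebra

section Linear

variable (S : Type u) [CommRing S] (Γ : Type u) [Ring Γ] [Algebra S Γ]

/-- The category of modules over an `S`-algebra is `S`-linear. Mathlib states this for algebras over
a field. -/
abbrev linearOfAlgebra : Linear S (ModuleCat.{u} Γ) where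
  homModule _ _ := inferInstance

end Linear

attribute [local instance] linearOfAlgebra

section BaseChange

variable {S : Type u} [CommRing S] (A : Type u) [CommRing A] [Algebra S A]
  {Γ : Type u} [Ring Γ] [Algebra S Γ]

theorem hom_smul_apply {M N : ModuleCat.{u} Γ} (s : S) (f : M ⟶ N) (x : M) :
    (s • f).hom x = s • f.hom x := rfl

/-- The pure tensor `a ⊗ m`, as an element of the `A ⊗[S] Γ`-module `A ⊗[S] M`. The definition keeps
apart the object `(baseChange S A Γ).obj M` and the tensor product underlying it, on which different
module structures are found. -/
def pureTensor (S : Type u) [CommRing S] {A : Type u} [CommRing A] [Algebra S A]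
    {Γ : Type u} [Ring Γ] [Algebra S Γ] {M : ModuleCat.{u} Γ} (a : A) (m : M) :
    (baseChange S A Γ).obj M :=
  (a ⊗ₜ[S] m : A ⊗[S] M)

variable {A}

theorem tmul_smul_pureTensor {M : ModuleCat.{u} Γ} (a b : A) (g : Γ) (m : M) :
    (a ⊗ₜ[S] g : A ⊗[S] Γ) • pureTensor S b m = pureTensor S (a * b) (g • m) := rfl

theorem smul_pureTensor {M : ModuleCat.{u} Γ} (a b : A) (m : M) :
    a • pureTensor S b m = pureTensor S (a * b) m := by
  rw [← algebraMap_smul (A ⊗[S] Γ) a, Algebra.TensorProduct.algebraMap_apply,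
    tmul_smul_pureTensor, one_smul]
  rfl

theorem baseChange_map_pureTensor {M N : ModuleCat.{u} Γ} (f : M ⟶ N) (a : A) (m : M) :
    ((baseChange S A Γ).map f).hom (pureTensor S a m) = pureTensor S a (f.hom m) := rfl

theorem pureTensor_induction {M : ModuleCat.{u} Γ}
    {motive : (baseChange S A Γ).obj M → Prop} (x : (baseChange S A Γ).obj M)
    (zero : motive 0) (tmul : ∀ a m, motive (pureTensor S a m))
    (add : ∀ x y, motive x → motive y → motive (x + y)) : motive x :=
  TensorProduct.induction_on (motive := motive) x zero tmul add

theorem baseChange_hom_ext {M : ModuleCat.{u} Γ} {N : ModuleCat.{u} (A ⊗[S] Γ)}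
    {f g : (baseChange S A Γ).obj M ⟶ N}
    (h : ∀ m, f.hom (pureTensor S 1 m) = g.hom (pureTensor S 1 m)) : f = g := by
  ext x
  induction x using pureTensor_induction with
  | zero => simp
  | add x y hx hy => simp [hx, hy]
  | tmul a m =>
    have : pureTensor S a m = (a ⊗ₜ[S] (1 : Γ) : A ⊗[S] Γ) • pureTensor S 1 m := by
      rw [tmul_smul_pureTensor, one_smul, mul_one]
    rw [this, map_smul, map_smul, h]

theorem sum_pureTensor {ι : Type*} {M : ModuleCat.{u} Γ} (t : Finset ι) (a : A) (m : ι → M) :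
    ∑ j ∈ t, pureTensor S a (m j) = pureTensor S a (∑ j ∈ t, m j) :=
  (TensorProduct.tmul_sum a t m).symm

theorem baseChange_map_smul {M N : ModuleCat.{u} Γ} (s : S) (f : M ⟶ N) :
    (baseChange S A Γ).map (s • f) = algebraMap S A s • (baseChange S A Γ).map f :=
  baseChange_hom_ext fun m => by
    rw [hom_smul_apply, baseChange_map_pureTensor, baseChange_map_pureTensor, hom_smul_apply,
      smul_pureTensor, ← Algebra.smul_def]
    exact (TensorProduct.smul_tmul s (1 : A) (f.hom m)).symm

/-- The base change `a ⊗ m ↦ a ⊗ f m` of a linear form `f` on a `Γ`-module. -/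
def baseChangeForm (S : Type u) [CommRing S] (A : Type u) [CommRing A] [Algebra S A]
    {Γ : Type u} [Ring Γ] [Algebra S Γ] {M : ModuleCat.{u} Γ} (f : M →ₗ[Γ] Γ) :
    (baseChange S A Γ).obj M →ₗ[A ⊗[S] Γ] A ⊗[S] Γ where
  toFun x := (f.restrictScalars S).lTensor A x
  map_add' := map_add _
  map_smul' r x := by
    suffices h : ∀ x : A ⊗[S] M, (f.restrictScalars S).lTensor A (baseChangeAction A M r x) =
        r * (f.restrictScalars S).lTensor A x from h x
    intro x
    induction r using TensorProduct.induction_on with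
    | zero => simp
    | add r₁ r₂ h₁ h₂ => rw [map_add, LinearMap.add_apply, map_add, h₁, h₂, add_mul]
    | tmul a g =>
      induction x using TensorProduct.induction_on with
      | zero => simp
      | add x y hx hy => rw [map_add, map_add, hx, hy, map_add, mul_add]
      | tmul b m => simp [baseChangeAction_tmul_tmul]

theorem baseChangeForm_pureTensor {M : ModuleCat.{u} Γ} (f : M →ₗ[Γ] Γ) (a : A) (m : M) :
    baseChangeForm S A f (pureTensor S a m) = a ⊗ₜ[S] f m := rfl

/-- Base change preserves finitely generated projective modules. -/
theorem finite_and_projective_baseChange (M : ModuleCat.{u} Γ) [Module.Finite Γ M]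
    [Module.Projective Γ M] :
    Module.Finite (A ⊗[S] Γ) ((baseChange S A Γ).obj M) ∧
      Module.Projective (A ⊗[S] Γ) ((baseChange S A Γ).obj M) := by
  obtain ⟨k, e, f, h⟩ := exists_dualBasis Γ M
  refine finite_and_projective_of_dualBasis (fun j => pureTensor S 1 (e j))
    (fun j => baseChangeForm S A (f j)) fun x => ?_
  induction x using pureTensor_induction with
  | zero => simp
  | add x y hx hy => simp only [map_add, add_smul, Finset.sum_add_distrib, hx, hy]
  | tmul a m =>
    conv_rhs => rw [← h m, ← sum_pureTensor]
    refine Finset.sum_congr rfl fun j _ => ?_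
    rw [baseChangeForm_pureTensor, tmul_smul_pureTensor, mul_one]

theorem IsBoundedProj.baseChangeComplex {T : CochainComplex (ModuleCat.{u} Γ) ℤ}
    (hT : IsBoundedProj T) : IsBoundedProj (baseChangeComplex S A T) where
  projective i :=
    have := hT.projective i
    have := hT.finite i
    (finite_and_projective_baseChange (S := S) (A := A) (T.X i)).2
  finite i :=
    have := hT.projective i
    have := hT.finite i
    (finite_and_projective_baseChange (S := S) (A := A) (T.X i)).1
  bounded := by
    obtain ⟨a, b, h⟩ := hT.bounded
    exact ⟨a, b, fun i hi => (baseChange S A Γ).map_isZero (h i hi)⟩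

end BaseChange

/-! ### Base change of Hom complexes -/

section Comparison

variable {S : Type u} [CommRing S] (A : Type u) [CommRing A] [Algebra S A]
  {Γ : Type u} [Ring Γ] [Algebra S Γ] {T K : CochainComplex (ModuleCat.{u} Γ) ℤ} {n : ℤ}

/-- The cochain `id ⊗ z` from `A ⊗[S] T` to `A ⊗[S] K`. -/
def baseChangeCochain (S : Type u) [CommRing S] (A : Type u) [CommRing A] [Algebra S A]
    [Algebra S Γ] (z : Cochain T K n) :
    Cochain (baseChangeComplex S A T) (baseChangeComplex S A K) n :=
  z.map (baseChange S A Γ)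

theorem baseChangeCochain_add (z z' : Cochain T K n) :
    baseChangeCochain S A (z + z') = baseChangeCochain S A z + baseChangeCochain S A z' :=
  Cochain.map_add ..

theorem baseChangeCochain_smul (s : S) (z : Cochain T K n) :
    baseChangeCochain S A (s • z) = algebraMap S A s • baseChangeCochain S A z := by
  ext1 p q hpq
  exact baseChange_map_smul s (z.v p q hpq)

theorem δ_baseChangeCochain (n m : ℤ) (z : Cochain T K n) :
    δ n m (baseChangeCochain S A z) = baseChangeCochain S A (δ n m z) :=
  δ_map ..

/-- The comparison map `A ⊗[S] Hom(T, K) → Hom(A ⊗[S] T, A ⊗[S] K)`, `a ⊗ z ↦ a • (id ⊗ z)`, in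
cochain degree `n`. -/
noncomputable def comparison (T K : CochainComplex (ModuleCat.{u} Γ) ℤ) (n : ℤ) :
    A ⊗[S] Cochain T K n →+ Cochain (baseChangeComplex S A T) (baseChangeComplex S A K) n :=
  TensorProduct.liftAddHom
    (AddMonoidHom.mk' (fun a => AddMonoidHom.mk' (fun z => a • baseChangeCochain S A z)
      fun z z' => by rw [baseChangeCochain_add, smul_add])
      fun a a' => by ext1 z; exact add_smul a a' (baseChangeCochain S A z))
    fun s a z => by
      change (s • a) • baseChangeCochain S A z = a • baseChangeCochain S A (s • z)
      rw [baseChangeCochain_smul, smul_smul, mul_comm, Algebra.smul_def]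

variable {A}

theorem comparison_tmul (a : A) (z : Cochain T K n) :
    comparison A T K n (a ⊗ₜ[S] z) = a • baseChangeCochain S A z := rfl

theorem δ_comparison (n m : ℤ) (x : A ⊗[S] Cochain T K n) :
    δ n m (comparison A T K n x) = comparison A T K m ((δ_hom S T K n m).lTensor A x) := by
  induction x using TensorProduct.induction_on with
  | zero => simp
  | add x y hx hy => rw [map_add, δ_add, hx, hy, map_add, map_add]
  | tmul a z =>
    rw [LinearMap.lTensor_tmul, comparison_tmul, comparison_tmul, δ_smul, δ_hom_apply,
      δ_baseChangeCochain]

/-- For a linear form `f` on `T.X p`, the map sending `m` to the cochain that is `x ↦ f x • m` on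
`T.X p` and zero elsewhere. -/
noncomputable def elementaryCochain (S : Type u) [CommRing S] [Algebra S Γ]
    (T K : CochainComplex (ModuleCat.{u} Γ) ℤ) (n : ℤ) {p : ℤ}
    (f : T.X p →ₗ[Γ] Γ) : K.X (p + n) →ₗ[S] Cochain T K n where
  toFun m := Cochain.single (ModuleCat.ofHom ((LinearMap.toSpanSingleton Γ _ m).comp f)) n
  map_add' m m' := by
    ext1 p' q' hpq'
    rw [Cochain.add_v]
    by_cases h : p' = p
    · subst h
      obtain rfl := hpq'
      simp only [Cochain.single_v]
      ext x
      exact smul_add (f x) m m'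
    · simp only [Cochain.single_v_eq_zero _ _ _ _ hpq' h, add_zero]
  map_smul' s m := by
    ext1 p' q' hpq'
    rw [RingHom.id_apply, Cochain.smul_v]
    by_cases h : p' = p
    · subst h
      obtain rfl := hpq'
      simp only [Cochain.single_v]
      ext x
      exact smul_comm (f x) s m
    · simp only [Cochain.single_v_eq_zero _ _ _ _ hpq' h, smul_zero]

theorem elementaryCochain_v_apply {p : ℤ} (f : T.X p →ₗ[Γ] Γ) (m : K.X (p + n)) (x : T.X p) :
    ((elementaryCochain S T K n f m).v p (p + n) rfl).hom x = f x • m := by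
  change (((Cochain.single _ n).v p (p + n) rfl : T.X p ⟶ K.X (p + n))).hom x = _
  rw [Cochain.single_v]
  rfl

theorem elementaryCochain_v_eq_zero {p : ℤ} (f : T.X p →ₗ[Γ] Γ) (m : K.X (p + n)) (p' q' : ℤ)
    (h : p' + n = q') (hp' : p' ≠ p) : (elementaryCochain S T K n f m).v p' q' h = 0 :=
  Cochain.single_v_eq_zero _ _ _ _ h hp'

/-- The value at `1 ⊗ x` of a cochain from `A ⊗[S] T` to `A ⊗[S] K`. -/
noncomputable def evalOneTmul (p : ℤ) (x : T.X p) :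
    Cochain (baseChangeComplex S A T) (baseChangeComplex S A K) n →+ A ⊗[S] K.X (p + n) where
  toFun h := (h.v p (p + n) rfl).hom (pureTensor S 1 x)
  map_zero' := rfl
  map_add' _ _ := rfl

theorem cochain_ext_of_evalOneTmul
    {h h' : Cochain (baseChangeComplex S A T) (baseChangeComplex S A K) n}
    (H : ∀ p x, evalOneTmul p x h = evalOneTmul p x h') : h = h' := by
  ext1 p q hpq
  obtain rfl := hpq
  exact baseChange_hom_ext (H p)

theorem evalOneTmul_sum {p : ℤ} {ι : Type*} (t : Finset ι) (g : ι → Γ) (e : ι → T.X p)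
    (h : Cochain (baseChangeComplex S A T) (baseChangeComplex S A K) n) :
    evalOneTmul p (∑ j ∈ t, g j • e j) h =
      ∑ j ∈ t, baseChangeAction A (K.X (p + n)) (1 ⊗ₜ[S] g j) (evalOneTmul p (e j) h) := by
  have hj (j : ι) : pureTensor S (1 : A) (g j • e j) =
      ((1 : A) ⊗ₜ[S] g j : A ⊗[S] Γ) • pureTensor S 1 (e j) := by
    rw [tmul_smul_pureTensor, one_mul]
  let φ : (baseChange S A Γ).obj (T.X p) →ₗ[A ⊗[S] Γ] (baseChange S A Γ).obj (K.X (p + n)) :=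
    (h.v p (p + n) rfl).hom
  change φ (pureTensor S 1 _) = _
  rw [← sum_pureTensor, map_sum]
  refine Finset.sum_congr rfl fun j _ => ?_
  rw [hj, map_smul]
  rfl

theorem evalOneTmul_comparison_tmul (p : ℤ) (x : T.X p) (a : A) (z : Cochain T K n) :
    evalOneTmul p x (comparison A T K n (a ⊗ₜ[S] z)) =
      a ⊗ₜ[S] (z.v p (p + n) rfl).hom x := by
  refine (smul_pureTensor a 1 ((z.v p (p + n) rfl).hom x)).trans ?_
  rw [mul_one]
  rfl

theorem evalOneTmul_comparison_elementaryCochain {p : ℤ} (f : T.X p →ₗ[Γ] Γ)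
    (y : A ⊗[S] K.X (p + n)) (x : T.X p) :
    evalOneTmul p x (comparison A T K n ((elementaryCochain S T K n f).lTensor A y)) =
      baseChangeAction A (K.X (p + n)) (1 ⊗ₜ[S] f x) y := by
  induction y using TensorProduct.induction_on with
  | zero => simp
  | add y z hy hz => simp only [map_add, hy, hz]
  | tmul a m =>
    rw [LinearMap.lTensor_tmul, evalOneTmul_comparison_tmul, elementaryCochain_v_apply,
      baseChangeAction_tmul_tmul, one_mul]

theorem evalOneTmul_comparison_elementaryCochain_of_ne {p p' : ℤ} (hp' : p' ≠ p)
    (f : T.X p →ₗ[Γ] Γ) (y : A ⊗[S] K.X (p + n)) (x : T.X p') :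
    evalOneTmul p' x (comparison A T K n ((elementaryCochain S T K n f).lTensor A y)) = 0 := by
  induction y using TensorProduct.induction_on with
  | zero => simp
  | add y z hy hz => simp only [map_add, hy, hz, add_zero]
  | tmul a m =>
    rw [LinearMap.lTensor_tmul, evalOneTmul_comparison_tmul,
      elementaryCochain_v_eq_zero f m p' _ rfl hp']
    exact TensorProduct.tmul_zero _ a

/-- If `T` is a bounded complex of finitely generated projective modules, then
`A ⊗[S] Hom(T, K) → Hom(A ⊗[S] T, A ⊗[S] K)` is bijective in each degree. -/
theorem comparison_bijective (hT : IsBoundedProj T) (K : CochainComplex (ModuleCat.{u} Γ) ℤ)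
    (n : ℤ) : Function.Bijective (comparison (S := S) A T K n) := by
  obtain ⟨a, b, hab⟩ := hT.bounded
  have hzero (p : ℤ) (hp : p ∉ Finset.Icc a b) (x : T.X p) : x = 0 := by
    have : Limits.IsZero (T.X p) := hab p (by rw [Finset.mem_Icc] at hp; lia)
    exact (ModuleCat.subsingleton_of_isZero this).elim x 0
  have hdual (p : ℤ) : ∃ (k : ℕ) (e : Fin k → T.X p) (f : Fin k → T.X p →ₗ[Γ] Γ),
      ∀ x, ∑ j, f j x • e j = x :=
    have := hT.projective p
    have := hT.finite p
    exists_dualBasis Γ (T.X p)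
  choose k e f hef using hdual
  -- In terms of the dual bases `e p`, `f p` of `T.X p`, the inverse sends `h` to the sum of the
  -- cochains `x ↦ f p j x • h (1 ⊗ e p j)`.
  let inv : Cochain (baseChangeComplex S A T) (baseChangeComplex S A K) n →+
      A ⊗[S] Cochain T K n :=
    ∑ p ∈ Finset.Icc a b, ∑ j,
      ((elementaryCochain S T K n (f p j)).lTensor A).toAddMonoidHom.comp (evalOneTmul p (e p j))
  have inv_apply (h) : inv h = ∑ p ∈ Finset.Icc a b, ∑ j,
      (elementaryCochain S T K n (f p j)).lTensor A (evalOneTmul p (e p j) h) := by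
    simp [inv, AddMonoidHom.finsetSum_apply]
  refine Function.bijective_iff_has_inverse.2 ⟨inv, fun x => ?_, fun h => ?_⟩
  · induction x using TensorProduct.induction_on with
    | zero => simp
    | add x y hx hy => rw [map_add, map_add, hx, hy]
    | tmul c z =>
      simp only [inv_apply, evalOneTmul_comparison_tmul, LinearMap.lTensor_tmul,
        ← TensorProduct.tmul_sum]
      congr 1
      ext p q hpq x
      obtain rfl := hpq
      -- Evaluation at `x` kills the summands of index other than `p`, and the dual basis of `T.X p`
      -- recovers `z x` from the others.
      let ev : Cochain T K n →+ K.X (p + n) :=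
        { toFun := fun z => (z.v p (p + n) rfl).hom x
          map_zero' := rfl
          map_add' := fun _ _ => rfl }
      have hev {p' : ℤ} (f : T.X p' →ₗ[Γ] Γ) (m : K.X (p' + n)) (hp' : p' ≠ p) :
          ev (elementaryCochain S T K n f m) = 0 := by
        change ((elementaryCochain S T K n f m).v p (p + n) rfl).hom x = 0
        rw [elementaryCochain_v_eq_zero f m p _ rfl hp'.symm]
        rfl
      change ev _ = ev z
      by_cases hp : p ∈ Finset.Icc a b
      · rw [map_sum, Finset.sum_eq_single_of_mem p hp, map_sum]
        · conv_rhs => rw [show ev z = (z.v p (p + n) rfl).hom x from rfl, ← hef p x, map_sum]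
          refine Finset.sum_congr rfl fun j _ => ?_
          rw [map_smul]
          exact elementaryCochain_v_apply (f p j) _ x
        · exact fun p' _ hp' => (map_sum ..).trans (Finset.sum_eq_zero fun j _ => hev _ _ hp')
      · have hx := hzero p hp x
        have (z : Cochain T K n) : ev z = 0 := by
          change (z.v p (p + n) rfl).hom x = 0
          rw [hx, map_zero]
        rw [this, this]
  · refine cochain_ext_of_evalOneTmul fun p x => ?_
    simp only [inv_apply, map_sum]
    by_cases hp : p ∈ Finset.Icc a b
    · rw [Finset.sum_eq_single_of_mem p hp]
      · simp only [evalOneTmul_comparison_elementaryCochain]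
        rw [← evalOneTmul_sum, hef]
      · intro p' _ hp'
        exact Finset.sum_eq_zero fun j _ =>
          evalOneTmul_comparison_elementaryCochain_of_ne hp'.symm _ _ _
    · rw [hzero p hp x]
      have (g : Cochain (baseChangeComplex S A T) (baseChangeComplex S A K) n) :
          evalOneTmul p (0 : T.X p) g = 0 := by
        simpa using evalOneTmul_sum ∅ (fun _ : ℕ => (0 : Γ)) (fun _ => (0 : T.X p)) g
      simp [this]

end Comparison

/-! ### Jointly faithful families of algebras -/

section JointlyFaithful

variable {S : Type u} [CommRing S]

/-- A family `A` of `S`-algebras is jointly faithful if an `S`-module `M` vanishes as soon as all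
the modules `A j ⊗[S] M` do. -/
def JointlyFaithful (S : Type u) [CommRing S] {ι : Type*} (A : ι → Type u) [∀ j, CommRing (A j)]
    [∀ j, Algebra S (A j)] : Prop :=
  ∀ (M : Type u) [AddCommGroup M] [Module S M], (∀ j, Subsingleton (A j ⊗[S] M)) → Subsingleton M

variable {ι : Type*} {A : ι → Type u} [∀ j, CommRing (A j)] [∀ j, Algebra S (A j)]

/-- A jointly faithful family of flat algebras detects exactness at the middle term. Only the
inclusion of the kernel in the range is concerned, and `g ∘ f = 0` is not assumed. -/
theorem JointlyFaithful.mem_range_of_eq_zero [∀ j, Module.Flat S (A j)] (hA : JointlyFaithful S A)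
    {L M N : Type u} [AddCommGroup L] [AddCommGroup M] [AddCommGroup N] [Module S L] [Module S M]
    [Module S N] (f : L →ₗ[S] M) (g : M →ₗ[S] N)
    (h : ∀ j, ∀ x, g.lTensor (A j) x = 0 → ∃ y, f.lTensor (A j) y = x) {x : M} (hx : g x = 0) :
    ∃ y, f y = x := by
  -- The cyclic submodule generated by the class of `x` in the cokernel of `f` vanishes after
  -- tensoring with each `A j`.
  let E := Submodule.span S {f.range.mkQ x}
  suffices Subsingleton E by
    have h0 : f.range.mkQ x = 0 := congrArg Subtype.val
      (Subsingleton.elim (⟨_, Submodule.mem_span_singleton_self _⟩ : E) 0)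
    rwa [Submodule.mkQ_apply, Submodule.Quotient.mk_eq_zero] at h0
  refine hA E fun j => subsingleton_of_forall_eq 0 fun t => ?_
  apply Module.Flat.lTensor_preserves_injective_linearMap (M := A j) E.subtype E.injective_subtype
  rw [map_zero]
  induction t using TensorProduct.induction_on with
  | zero => simp
  | add t t' ht ht' => rw [map_add, ht, ht', add_zero]
  | tmul a e =>
    obtain ⟨e, he⟩ := e
    obtain ⟨s, rfl⟩ := Submodule.mem_span_singleton.1 he
    obtain ⟨y, hy⟩ := h j (a ⊗ₜ x) (by rw [LinearMap.lTensor_tmul, hx, TensorProduct.tmul_zero])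
    have h0 : a ⊗ₜ[S] f.range.mkQ x = 0 := by
      rw [← LinearMap.lTensor_tmul, ← hy, ← LinearMap.lTensor_comp_apply, LinearMap.range_mkQ_comp,
        LinearMap.lTensor_zero, LinearMap.zero_apply]
    rw [LinearMap.lTensor_tmul, Submodule.subtype_apply, TensorProduct.tmul_smul, h0, smul_zero]

theorem jointlyFaithful_of_faithfullyFlat (B : Type u) [CommRing B] [Algebra S B]
    [Module.FaithfullyFlat S B] : JointlyFaithful S fun _ : Unit => B :=
  fun M _ _ h =>
    have := h ()
    Module.FaithfullyFlat.lTensor_reflects_triviality S B M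

theorem jointlyFaithful_locRing : JointlyFaithful S (fun p : PrimeSpectrum S => LocRing p) := by
  intro M _ _ h
  refine Module.subsingleton_of_localization_maximal (R := S)
    (fun m _ => LocalizedModule m.primeCompl M)
    (fun m _ => LocalizedModule.mkLinearMap m.primeCompl M)
    fun m hm => ?_
  have : Subsingleton (Localization.AtPrime m ⊗[S] M) := h ⟨m, hm.isPrime⟩
  exact (LocalizedModule.equivTensorProduct m.primeCompl M).toEquiv.subsingleton

/-- The completion of a Noetherian local ring is faithfully flat. -/
theorem faithfullyFlat_adicCompletion_maximalIdeal (R : Type u) [CommRing R] [IsLocalRing R]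
    [IsNoetherianRing R] :
    Module.FaithfullyFlat R (AdicCompletion (IsLocalRing.maximalIdeal R) R) :=
  Module.FaithfullyFlat.of_flat_of_isLocalHom

end JointlyFaithful

/-! ### Descent of exactness -/

section Descent

variable {S : Type u} [CommRing S] {Γ : Type u} [Ring Γ] [Algebra S Γ]
  {T K : CochainComplex (ModuleCat.{u} Γ) ℤ} {n : ℤ}

/-- The comparison isomorphism reduces exactness of `Hom(A ⊗[S] T, A ⊗[S] K)` to that of
`A ⊗[S] Hom(T, K)`. -/
theorem homExactAt_baseChange_iff (hT : IsBoundedProj T) (A : Type u) [CommRing A] [Algebra S A] :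
    HomExactAt (baseChangeComplex S A T) (baseChangeComplex S A K) n ↔
      ∀ x, (δ_hom S T K n (n + 1)).lTensor A x = 0 →
        ∃ y, (δ_hom S T K (n - 1) n).lTensor A y = x := by
  constructor
  · intro h x hx
    obtain ⟨y, hy⟩ := h (comparison A T K n x) (by rw [δ_comparison, hx, map_zero])
    obtain ⟨y, rfl⟩ := (comparison_bijective hT K (n - 1)).2 y
    exact ⟨y, (comparison_bijective hT K n).1 (by rw [← δ_comparison, hy])⟩
  · intro h z hz
    obtain ⟨x, rfl⟩ := (comparison_bijective hT K n).2 z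
    rw [δ_comparison] at hz
    obtain ⟨y, rfl⟩ := h x ((comparison_bijective hT K (n + 1)).1 (by rw [hz, map_zero]))
    exact ⟨comparison A T K (n - 1) y, δ_comparison ..⟩

theorem HomExactAt.baseChange (hT : IsBoundedProj T) (h : HomExactAt T K n) (A : Type u)
    [CommRing A] [Algebra S A] [Module.Flat S A] :
    HomExactAt (baseChangeComplex S A T) (baseChangeComplex S A K) n := by
  rw [homExactAt_baseChange_iff hT]
  have : Function.Exact (δ_hom S T K (n - 1) n) (δ_hom S T K n (n + 1)) := fun z =>
    ⟨h z, by rintro ⟨y, rfl⟩; exact δ_δ ..⟩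
  exact fun x hx => (Module.Flat.lTensor_exact A this x).1 hx

variable {ι : Type*} {A : ι → Type u} [∀ j, CommRing (A j)] [∀ j, Algebra S (A j)]
  [∀ j, Module.Flat S (A j)]

theorem JointlyFaithful.homExactAt (hA : JointlyFaithful S A) (hT : IsBoundedProj T)
    (h : ∀ j, HomExactAt (baseChangeComplex S (A j) T) (baseChangeComplex S (A j) K) n) :
    HomExactAt T K n := fun _ hz =>
  hA.mem_range_of_eq_zero (δ_hom S T K (n - 1) n) (δ_hom S T K n (n + 1))
    (fun j => (homExactAt_baseChange_iff hT (A j)).1 (h j)) hz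

theorem JointlyFaithful.acyclic (hA : JointlyFaithful S A)
    (h : ∀ j, (baseChangeComplex S (A j) K).Acyclic) : K.Acyclic := by
  rw [acyclic_iff_of_moduleCat]
  intro i x hx
  exact hA.mem_range_of_eq_zero ((K.d (i - 1) i).hom.restrictScalars S)
    ((K.d i (i + 1)).hom.restrictScalars S)
    (fun j => (acyclic_iff_of_moduleCat _).1 (h j) i) hx

end Descent

/-! ### Extension and restriction of scalars -/

section Adjunction

variable {S : Type u} [CommRing S] (A : Type u) [CommRing A] [Algebra S A]
  {Γ : Type u} [Ring Γ] [Algebra S Γ]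

variable (S Γ) in
/-- Restriction of scalars along `Γ → A ⊗[S] Γ`. -/
noncomputable abbrev restriction : ModuleCat.{u} (A ⊗[S] Γ) ⥤ ModuleCat.{u} Γ :=
  ModuleCat.restrictScalars (Algebra.TensorProduct.includeRight : Γ →ₐ[S] A ⊗[S] Γ).toRingHom

/-- The unit `m ↦ 1 ⊗ m`. -/
noncomputable def unitHom (M : ModuleCat.{u} Γ) :
    M ⟶ (restriction S A Γ).obj ((baseChange S A Γ).obj M) :=
  ModuleCat.ofHom (Y := (restriction S A Γ).obj ((baseChange S A Γ).obj M))
    { toFun := fun m => pureTensor S 1 m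
      map_add' := TensorProduct.tmul_add 1
      map_smul' := fun g m => by
        refine Eq.trans ?_ (tmul_smul_pureTensor (1 : A) 1 g m).symm
        rw [one_mul] }

/-- The additive map `a ⊗ x ↦ (a ⊗ 1) • x` underlying the counit. -/
noncomputable def counitAddHom (N : ModuleCat.{u} (A ⊗[S] Γ)) :
    A ⊗[S] (restriction S A Γ).obj N →+ N :=
  TensorProduct.liftAddHom
    (AddMonoidHom.mk' (fun a => AddMonoidHom.mk' (fun x : N => (a ⊗ₜ[S] (1 : Γ) : A ⊗[S] Γ) • x)
      fun _ _ => smul_add _ _ _)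
      fun a a' => by
        ext1 x
        change ((a + a') ⊗ₜ[S] (1 : Γ) : A ⊗[S] Γ) • x = _
        rw [TensorProduct.add_tmul, add_smul]
        rfl)
    fun s a x => by
      change ((s • a) ⊗ₜ[S] (1 : Γ) : A ⊗[S] Γ) • (x : N) =
        (a ⊗ₜ[S] (1 : Γ) : A ⊗[S] Γ) • (1 ⊗ₜ[S] algebraMap S Γ s : A ⊗[S] Γ) • (x : N)
      rw [smul_smul, Algebra.TensorProduct.tmul_mul_tmul, mul_one, one_mul,
        TensorProduct.smul_tmul, Algebra.smul_def, mul_one]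

theorem counitAddHom_baseChangeAction (N : ModuleCat.{u} (A ⊗[S] Γ)) (r : A ⊗[S] Γ)
    (x : A ⊗[S] (restriction S A Γ).obj N) :
    counitAddHom A N (baseChangeAction A ((restriction S A Γ).obj N) r x) =
      r • counitAddHom A N x := by
  induction x using TensorProduct.induction_on with
  | zero => simp
  | add x y hx hy => rw [map_add, map_add, hx, hy, map_add, smul_add]
  | tmul b x =>
    induction r using TensorProduct.induction_on with
    | zero => simp
    | add r₁ r₂ h₁ h₂ => rw [map_add, LinearMap.add_apply, map_add, h₁, h₂, add_smul]
    | tmul a g =>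
      change ((a * b) ⊗ₜ[S] (1 : Γ) : A ⊗[S] Γ) • (1 ⊗ₜ[S] g : A ⊗[S] Γ) • (x : N) =
        (a ⊗ₜ[S] g : A ⊗[S] Γ) • (b ⊗ₜ[S] (1 : Γ) : A ⊗[S] Γ) • (x : N)
      simp only [smul_smul, Algebra.TensorProduct.tmul_mul_tmul, mul_one, one_mul]

/-- The counit `a ⊗ x ↦ (a ⊗ 1) • x`. -/
noncomputable def counitHom (N : ModuleCat.{u} (A ⊗[S] Γ)) :
    (baseChange S A Γ).obj ((restriction S A Γ).obj N) ⟶ N :=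
  ModuleCat.ofHom (X := (baseChange S A Γ).obj ((restriction S A Γ).obj N))
    { toFun := counitAddHom A N
      map_add' := map_add (counitAddHom A N)
      map_smul' := counitAddHom_baseChangeAction A N }

variable {A}

/-- The counit restricts to the identity on `1 ⊗ N`. -/
theorem counitHom_pureTensor_one (N : ModuleCat.{u} (A ⊗[S] Γ)) (x : N) :
    (counitHom A N).hom (pureTensor (M := (restriction S A Γ).obj N) S 1 x) = x :=
  one_smul (A ⊗[S] Γ) x

theorem counitHom_naturality {N N' : ModuleCat.{u} (A ⊗[S] Γ)} (f : N ⟶ N') :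
    (baseChange S A Γ).map ((restriction S A Γ).map f) ≫ counitHom A N' = counitHom A N ≫ f :=
  baseChange_hom_ext fun x => (f.hom.map_smul ((1 : A) ⊗ₜ[S] (1 : Γ)) x).symm

/-- The restriction of a complex of `A ⊗[S] Γ`-modules to `Γ`. -/
noncomputable abbrev restrictionComplex (K : CochainComplex (ModuleCat.{u} (A ⊗[S] Γ)) ℤ) :
    CochainComplex (ModuleCat.{u} Γ) ℤ :=
  ((restriction S A Γ).mapHomologicalComplex (ComplexShape.up ℤ)).obj K

/-- The unit as a morphism of complexes. -/
noncomputable def unitComplex (A : Type u) [CommRing A] [Algebra S A]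
    (T : CochainComplex (ModuleCat.{u} Γ) ℤ) :
    T ⟶ restrictionComplex (baseChangeComplex S A T) where
  f i := unitHom A (T.X i)

/-- The counit as a morphism of complexes. -/
noncomputable def counitComplex (K : CochainComplex (ModuleCat.{u} (A ⊗[S] Γ)) ℤ) :
    baseChangeComplex S A (restrictionComplex K) ⟶ K where
  f i := counitHom A (K.X i)
  comm' i j _ := (counitHom_naturality (K.d i j)).symm

/-- If `Hom(A ⊗[S] T, K)` is exact in some degree, so is `Hom(T, K)`: the transpose of a
cocycle under the adjunction between extension and restriction of scalars is a cocycle, hence a coboundary, and a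
cochain bounding it transposes back. -/
theorem HomExactAt.restrictScalars {T : CochainComplex (ModuleCat.{u} Γ) ℤ}
    {K : CochainComplex (ModuleCat.{u} (A ⊗[S] Γ)) ℤ} {n : ℤ}
    (h : HomExactAt (baseChangeComplex S A T) K n) : HomExactAt T (restrictionComplex K) n := by
  intro z hz
  obtain ⟨y, hy⟩ := h
    ((baseChangeCochain S A z).comp (Cochain.ofHom (counitComplex K)) (add_zero n))
    (by
      rw [δ_comp_ofHom, δ_baseChangeCochain, hz]
      have : baseChangeCochain S A (0 : Cochain T (restrictionComplex K) (n + 1)) = 0 :=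
        Cochain.map_zero ..
      rw [this, Cochain.zero_comp])
  refine ⟨(Cochain.ofHom (unitComplex A T)).comp (y.map (restriction S A Γ)) (zero_add _), ?_⟩
  rw [δ_ofHom_comp, δ_map, hy]
  ext p q hpq x
  rw [Cochain.zero_cochain_comp_v, Cochain.ofHom_v, Cochain.map_v, Cochain.comp_zero_cochain_v,
    Cochain.ofHom_v]
  exact counitHom_pureTensor_one (S := S) (K.X q) ((z.v p q hpq).hom x)

/-- Restriction of scalars changes neither the underlying sets nor the differentials. -/
theorem acyclic_of_acyclic_restrictionComplex {K : CochainComplex (ModuleCat.{u} (A ⊗[S] Γ)) ℤ}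
    (h : (restrictionComplex K).Acyclic) : K.Acyclic :=
  (acyclic_iff_of_moduleCat K).2 ((acyclic_iff_of_moduleCat (restrictionComplex K)).1 h)

end Adjunction

/-! ### Tilting complexes and base change -/

/-- Being a one-sided tilting complex can be tested after base change to a jointly faithful family
of flat algebras. -/
theorem JointlyFaithful.isOneSidedTilting_iff {S : Type u} [CommRing S] {ι : Type*}
    {A : ι → Type u} [∀ j, CommRing (A j)] [∀ j, Algebra S (A j)] [∀ j, Module.Flat S (A j)]
    (hA : JointlyFaithful S A) {Γ : Type u} [Ring Γ] [Algebra S Γ]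
    {T : CochainComplex (ModuleCat.{u} Γ) ℤ} (hT : IsBoundedProj T) :
    IsOneSidedTilting T ↔ ∀ j, IsOneSidedTilting (baseChangeComplex S (A j) T) := by
  have hTA (j : ι) : IsBoundedProj (baseChangeComplex S (A j) T) := hT.baseChangeComplex
  simp only [OneSidedTilting.isOneSidedTilting_iff hT,
    OneSidedTilting.isOneSidedTilting_iff (hTA _)]
  refine ⟨fun h j => ⟨fun t ht => (h.1 t ht).baseChange hT (A j), fun K hK => ?_⟩,
    fun h => ⟨fun t ht => hA.homExactAt hT fun j => (h j).1 t ht, fun K hK => ?_⟩⟩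
  · exact acyclic_of_acyclic_restrictionComplex (S := S) (h.2 _ fun n => (hK n).restrictScalars)
  · exact hA.acyclic fun j => (h j).2 _ fun n => (hK n).baseChange hT (A j)

end OneSidedTilting

theorem mainTheorem8 {S : Type u} [CommRing S] [IsNoetherianRing S]
    {Γ : Type u} [Ring Γ] [Algebra S Γ] [Module.Finite S Γ]
    (T : CochainComplex (ModuleCat.{u} Γ) ℤ) (hT : OneSidedTilting.IsBoundedProj T) :
    List.TFAE [
      OneSidedTilting.IsOneSidedTilting T,
      ∀ p : PrimeSpectrum S,
        OneSidedTilting.IsOneSidedTilting (OneSidedTilting.localizedComplex p T),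
      ∀ p : PrimeSpectrum S,
        OneSidedTilting.IsOneSidedTilting (OneSidedTilting.completedComplex p T)] := by
  tfae_have 1 ↔ 2 := OneSidedTilting.jointlyFaithful_locRing.isOneSidedTilting_iff hT
  tfae_have 2 ↔ 3 := forall_congr' fun p => by
    have := OneSidedTilting.faithfullyFlat_adicCompletion_maximalIdeal (OneSidedTilting.LocRing p)
    exact ((OneSidedTilting.jointlyFaithful_of_faithfullyFlat
      (S := OneSidedTilting.LocRing p) (OneSidedTilting.ComplRing p)).isOneSidedTilting_iff
        hT.baseChangeComplex).trans (forall_const Unit)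
  tfae_finish
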